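/- Let $G$ be a finite group, let $p$ be the smallest prime divisor of $|G|$, and let $S$ be a Sylow $p$-subgroup of $G$. A subgroup $B\le G$ is called $S$-permutable in $G$ if $BQ=QB$ for every Sylow subgroup $Q$ of $G$ (for every prime). For a subgroup $H\le G$ let $H_{sG}$ be the subgroup generated by all subgroups of $H$ that are $S$-permutable in $G$, and let $\Phi(H)$ be the Frattini subgroup of $H$. A subgroup $H\le G$ is called weakly $S\Phi$-supplemented in $G$ if there is a subgroup $T\le G$ with $G=HT$ and $H\cap T\le \Phi(H)H_{sG}$. Suppose that $\exp(S)=p$ and that every minimal subgroup of $S$ (that is, every minimal non-trivial subgroup) is weakly $S\Phi$-supplemented in $G$. Then $G$ is $p$-nilpotent, i.e. $G$ has a normal subgroup $N$ of order prime to $p$ such that $G/N$ is a $p$-group. -/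

import Mathlib

open scoped Pointwise

/-- `A` is `S`-permutable in `G`: `A Q = Q A` for all Sylow subgroups `Q` of `G`
(for all primes `q`). -/
def IsSPermutable {G : Type*} [Group G] (A : Subgroup G) : Prop :=
  ∀ q : ℕ, q.Prime → ∀ Q : Sylow q G,
    (A : Set G) * ((Q : Subgroup G) : Set G) = ((Q : Subgroup G) : Set G) * (A : Set G)

/-- `A_{sG}`: the subgroup generated by all subgroups of `A` that are `S`-permutable in `G`. -/
def sPermutableCore {G : Type*} [Group G] (A : Subgroup G) : Subgroup G :=
  sSup {B : Subgroup G | B ≤ A ∧ IsSPermutable B}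

/-- The Frattini subgroup `Φ(A)` of the group `A`, as a subgroup of `G`. -/
def frattiniOf {G : Type*} [Group G] (A : Subgroup G) : Subgroup G :=
  (frattini A).map A.subtype

/-- `A` is weakly `SΦ`-supplemented in `G`: there is a subgroup `T` of `G` with `G = A T` and
`A ∩ T ⊆ Φ(A) A_{sG}`. -/
def IsWeaklySPhiSupplemented {G : Type*} [Group G] (A : Subgroup G) : Prop :=
  ∃ T : Subgroup G, (A : Set G) * (T : Set G) = Set.univ ∧
    (A : Set G) ∩ (T : Set G) ⊆ (frattiniOf A : Set G) * (sPermutableCore A : Set G)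

/-- A (finite) group is `p`-nilpotent if it has a normal `p`-complement: a normal subgroup of order
prime to `p` whose quotient is a `p`-group. -/
def IsPNilpotent (p : ℕ) (G : Type*) [Group G] : Prop :=
  ∃ N : Subgroup G, ∃ _ : N.Normal, (Nat.card N).Coprime p ∧ IsPGroup p (G ⧸ N)

/-! A subgroup H of order p has trivial Frattini subgroup and no proper non-trivial subgroups, so
weak supplementation says that H is S-permutable or has a complement T. In the second case T has
index p, hence is normal since p is the smallest prime divisor. In the first, H is centralized by
all q-elements with q ≠ p (`IsSPermutable.commute`). Induction on the order descends to a normal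
subgroup of index p while one exists. When none is left, exponent p puts every non-trivial element
of a Sylow p-subgroup in the first case, and Schur–Zassenhaus yields a normal complement
(`IsPNilpotent.of_commute`). -/

theorem exists_mem_sylow_of_pow_eq_one {G : Type*} [Group G] {q : ℕ} {y : G} {k : ℕ}
    (hy : y ^ q ^ k = 1) : ∃ Q : Sylow q G, y ∈ (Q : Subgroup G) := by
  have hP : IsPGroup q (Subgroup.zpowers y) :=
    IsPGroup.of_card_dvd_pow (n := k) (by
      rw [Nat.card_zpowers]; exact orderOf_dvd_of_pow_eq_one hy)
  obtain ⟨Q, hQ⟩ := hP.exists_le_sylow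
  exact ⟨Q, hQ (Subgroup.mem_zpowers y)⟩

theorem Sylow.exists_pow_eq_one {G : Type*} [Group G] {q : ℕ} (Q : Sylow q G) {y : G}
    (hy : y ∈ (Q : Subgroup G)) : ∃ k : ℕ, y ^ q ^ k = 1 := by
  obtain ⟨k, hk⟩ := Q.2 ⟨y, hy⟩
  exact ⟨k, by simpa [Subtype.ext_iff] using hk⟩

/-- A subgroup of a finite group containing a Sylow `q`-subgroup for each prime divisor `q` of the
group order is the whole group. -/
theorem Subgroup.eq_top_of_sylow_le {G : Type*} [Group G] [Finite G] (L : Subgroup G)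
    (h : ∀ q : ℕ, q.Prime → q ∣ Nat.card G → ∃ Q : Sylow q G, (Q : Subgroup G) ≤ L) :
    L = ⊤ := by
  rw [← Subgroup.index_eq_one]
  by_contra hne
  obtain ⟨q, hq, hqL⟩ := Nat.exists_prime_and_dvd hne
  have := Fact.mk hq
  obtain ⟨Q, hQL⟩ := h q hq (hqL.trans L.index_dvd_card)
  exact Q.not_dvd_index (hqL.trans (Subgroup.index_dvd_of_le hQL))

theorem Subgroup.coe_sup_of_mul_comm {G : Type*} [Group G] {H K : Subgroup G}
    (h : (H : Set G) * (K : Set G) = (K : Set G) * (H : Set G)) :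
    ((H ⊔ K : Subgroup G) : Set G) = (H : Set G) * (K : Set G) := by
  rw [Subgroup.sup_eq_closure_mul]
  refine Set.Subset.antisymm (fun x hx => ?_) Subgroup.subset_closure
  induction hx using Subgroup.closure_induction with
  | one => exact ⟨1, one_mem _, 1, one_mem _, mul_one 1⟩
  | mem _ hx => exact hx
  | inv x _ hx =>
    obtain ⟨a, ha, b, hb, rfl⟩ := hx
    rw [h]
    exact ⟨b⁻¹, inv_mem hb, a⁻¹, inv_mem ha, (mul_inv_rev a b).symm⟩
  | mul x y _ _ hx hy =>
    have h2 : (H : Set G) * (K : Set G) * ((H : Set G) * (K : Set G))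
        = (H : Set G) * (K : Set G) := by
      rw [mul_assoc, ← mul_assoc (K : Set G), ← h, mul_assoc, ← mul_assoc,
        coe_mul_coe, coe_mul_coe]
    exact h2 ▸ Set.mul_mem_mul hx hy

theorem Subgroup.relIndex_sup_of_mul_comm {G : Type*} [Group G] {H K : Subgroup G}
    (h : (H : Set G) * (K : Set G) = (K : Set G) * (H : Set G)) :
    K.relIndex (H ⊔ K) = K.relIndex H := by
  refine (Nat.card_congr (Equiv.ofBijective
    (Subgroup.quotientSubgroupOfEmbeddingOfLE K (le_sup_left : H ≤ H ⊔ K))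
    ⟨Function.Embedding.injective _, ?_⟩)).symm
  rintro ⟨x, hx⟩
  have hx' : x ∈ (H : Set G) * (K : Set G) := by
    rw [← Subgroup.coe_sup_of_mul_comm h]; exact hx
  obtain ⟨a, ha, b, hb, rfl⟩ := hx'
  refine ⟨QuotientGroup.mk ⟨a, ha⟩, ?_⟩
  refine QuotientGroup.eq.2 ?_
  rw [Subgroup.mem_subgroupOf]
  simpa using hb

/-- A `p`-subgroup permuting with a Sylow `p`-subgroup is contained in it. -/
theorem Sylow.le_of_mul_comm {G : Type*} [Group G] [Finite G] {p : ℕ} [Fact p.Prime]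
    (P : Sylow p G) {H : Subgroup G} (hH : IsPGroup p H)
    (h : (H : Set G) * ((P : Subgroup G) : Set G) = ((P : Subgroup G) : Set G) * (H : Set G)) :
    H ≤ P := by
  rw [← Subgroup.relIndex_eq_one]
  have h1 : (P : Subgroup G).relIndex H ∣ Nat.card H := Subgroup.relIndex_dvd_card _ _
  obtain ⟨k, hk⟩ := IsPGroup.iff_card.1 hH
  obtain ⟨m, -, hm⟩ := (Nat.dvd_prime_pow Fact.out).1 (hk ▸ h1)
  have h2 : ¬ p ∣ (P : Subgroup G).relIndex H := by
    rw [← Subgroup.relIndex_sup_of_mul_comm h]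
    exact fun hd => P.not_dvd_index
      (hd.trans (Subgroup.relIndex_dvd_index_of_le le_sup_right))
  rcases m with _ | m
  · rwa [pow_zero] at hm
  · exact absurd (hm ▸ dvd_pow_self p m.succ_ne_zero) h2

theorem IsPNilpotent.of_index_eq {p : ℕ} [Fact p.Prime] {G : Type*} [Group G] [Finite G]
    (N : Subgroup G) [hN : N.Normal] (hc : (Nat.card N).Coprime p)
    (hi : ∃ k, N.index = p ^ k) : IsPNilpotent p G := by
  obtain ⟨k, hk⟩ := hi
  exact ⟨N, hN, hc, IsPGroup.of_card (n := k) hk⟩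

/-- A normal `p`-complement of a normal subgroup of `p`-power index is a normal `p`-complement. -/
theorem IsPNilpotent.of_normal {p : ℕ} [Fact p.Prime] {G : Type*} [Group G] [Finite G]
    (T : Subgroup G) [hT : T.Normal] (hi : ∃ k, T.index = p ^ k) (h : IsPNilpotent p T) :
    IsPNilpotent p G := by
  obtain ⟨N, hN, hc, hq⟩ := h
  obtain ⟨k, hk⟩ := hi
  obtain ⟨m, hm⟩ := IsPGroup.iff_card.1 hq
  -- `N` contains every element of `T` of order dividing `|N|`, so conjugation by `G` preserves it.
  have key : ∀ t : T, t ^ Nat.card N = 1 → t ∈ N := by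
    intro t ht
    rw [← QuotientGroup.eq_one_iff]
    obtain ⟨j, hj⟩ := hq (t : T ⧸ N)
    have h1 : (t : T ⧸ N) ^ Nat.card N = 1 := by
      rw [← QuotientGroup.mk_pow, ht, QuotientGroup.mk_one]
    have h2 := Nat.dvd_gcd (orderOf_dvd_of_pow_eq_one h1) (orderOf_dvd_of_pow_eq_one hj)
    rw [Nat.Coprime.pow_right j hc] at h2
    exact orderOf_eq_one_iff.1 (Nat.dvd_one.1 h2)
  have hnorm : (N.map T.subtype).Normal := by
    constructor
    rintro _ ⟨n, hn, rfl⟩ g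
    refine ⟨⟨g * n * g⁻¹, hT.conj_mem _ n.2 g⟩, key _ ?_, rfl⟩
    have hn1 : (n : G) ^ Nat.card N = 1 := by
      have := congrArg (fun z : N => ((z : T) : G)) (pow_card_eq_one' (x := (⟨n, hn⟩ : N)))
      exact this
    ext
    simp [conj_pow, hn1]
  refine IsPNilpotent.of_index_eq (N.map T.subtype) ?_ ⟨m + k, ?_⟩
  · rwa [Subgroup.card_map_of_injective T.subtype_injective]
  · rw [Subgroup.index_map_subtype, hk, pow_add, ← hm]; rfl

/-- The normalizer of `S` contains a Sylow subgroup for every prime, so `S` is normal. A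
Schur–Zassenhaus complement centralizes `S`, and `G = SK` then makes it normal. -/
theorem IsPNilpotent.of_commute {p : ℕ} [Fact p.Prime] {G : Type*} [Group G] [Finite G]
    (S : Sylow p G)
    (h : ∀ x ∈ (S : Subgroup G), ∀ q : ℕ, q.Prime → q ≠ p → ∀ (y : G) (k : ℕ),
      y ^ q ^ k = 1 → Commute x y) : IsPNilpotent p G := by
  have hSn : (S : Subgroup G).Normal := by
    rw [← Subgroup.normalizer_eq_top_iff]
    refine Subgroup.eq_top_of_sylow_le _ fun q hq _ => ?_
    by_cases hqp : q = p
    · subst hqp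
      exact ⟨S, Subgroup.le_normalizer⟩
    · refine ⟨default, fun y hy => Subgroup.centralizer_le_normalizer _ ?_⟩
      obtain ⟨k, hk⟩ := Sylow.exists_pow_eq_one _ hy
      exact Subgroup.mem_centralizer_iff.2 fun x hx => h x hx q hq hqp y k hk
  obtain ⟨K, hK⟩ := Subgroup.exists_right_complement'_of_coprime S.card_coprime_index
  have hKi : (S : Subgroup G).index = Nat.card K := hK.symm.index_eq_card
  have hpK : ¬ p ∣ Nat.card K := hKi ▸ S.not_dvd_index
  have hKC : ∀ y ∈ K, ∀ x ∈ (S : Subgroup G), Commute x y := by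
    have hL : (Subgroup.centralizer ((S : Subgroup G) : Set G)).subgroupOf K = ⊤ := by
      refine Subgroup.eq_top_of_sylow_le _ fun q hq hqK => ⟨default, fun y hyQ => ?_⟩
      obtain ⟨k, hy⟩ := Sylow.exists_pow_eq_one _ hyQ
      rw [Subgroup.mem_subgroupOf, Subgroup.mem_centralizer_iff]
      intro x hx
      refine h x hx q hq (fun e => hpK (e ▸ hqK)) y k ?_
      simpa [Subtype.ext_iff] using hy
    intro y hy x hx
    exact Subgroup.mem_centralizer_iff.1 (Subgroup.subgroupOf_eq_top.1 hL hy) x hx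
  have hKn : K.Normal := by
    constructor
    intro n hn g
    obtain ⟨⟨s, t⟩, rfl⟩ := hK.2 g
    have hc : Commute (s : G) (t * n * (t : G)⁻¹) :=
      hKC _ (K.mul_mem (K.mul_mem t.2 hn) (K.inv_mem t.2)) s s.2
    have : (s * t : G) * n * (s * t : G)⁻¹ = t * n * (t : G)⁻¹ := by
      rw [mul_inv_rev, show (s * t : G) * n * ((t : G)⁻¹ * (s : G)⁻¹)
        = s * (t * n * (t : G)⁻¹) * (s : G)⁻¹ by group, hc.eq, mul_inv_cancel_right]
    simp only [this]
    exact K.mul_mem (K.mul_mem t.2 hn) (K.inv_mem t.2)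
  refine IsPNilpotent.of_index_eq K ?_ ?_
  · exact (((Fact.out : p.Prime).coprime_iff_not_dvd).2 hpK).symm
  · rw [hK.index_eq_card]
    exact IsPGroup.iff_card.1 S.2

/-- Stated for elements because this dichotomy passes to a normal subgroup of index p, which keeps
the induction free of supplements and S-permutability. -/
theorem isPNilpotent_of_normal_index_or_commute {p : ℕ} [Fact p.Prime] (n : ℕ) :
    ∀ {G : Type*} [Group G] [Finite G], Nat.card G = n →
    (∀ (x : G) (k : ℕ), x ^ p ^ k = 1 → x ^ p = 1) →
    (∀ x : G, x ^ p = 1 → x ≠ 1 →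
      (∃ T : Subgroup G, T.Normal ∧ T.index = p ∧ x ∉ T) ∨
      ∀ q : ℕ, q.Prime → q ≠ p → ∀ (y : G) (k : ℕ), y ^ q ^ k = 1 → Commute x y) →
    IsPNilpotent p G := by
  induction n using Nat.strong_induction_on with
  | _ n ih =>
  intro G _ _ hn hexp h
  by_cases hT : ∃ T : Subgroup G, T.Normal ∧ T.index = p
  · obtain ⟨T, hTn, hTi⟩ := hT
    refine IsPNilpotent.of_normal T ⟨1, by rw [hTi, pow_one]⟩ ?_
    refine ih (Nat.card T) ?_ rfl ?_ ?_
    · have h1 := T.card_mul_index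
      have h2 := (Fact.out : p.Prime).two_le
      have h3 : 0 < Nat.card T := Nat.card_pos
      rw [hTi, hn] at h1
      nlinarith
    · intro x k hx
      have := hexp x k (by simpa [Subtype.ext_iff] using hx)
      simpa [Subtype.ext_iff] using this
    · intro x hx hx1
      rcases h x (by simpa [Subtype.ext_iff] using hx) (by simpa using hx1) with
        ⟨U, hUn, hUi, hxU⟩ | hc
      · refine Or.inl ⟨U.subgroupOf T, inferInstance, ?_, fun hm => hxU hm⟩
        -- The index of `U ∩ T` in `T` is 1 or p; it is not 1, since `x` lies in `T` but not in `U`.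
        have hd : U.relIndex T ∣ p := hUi ▸ Subgroup.relIndex_dvd_index_of_normal U T
        refine ((Nat.dvd_prime Fact.out).1 hd).resolve_left fun h1 => hxU ?_
        exact Subgroup.relIndex_eq_one.1 h1 x.2
      · refine Or.inr fun q hq hqp y k hy => ?_
        have := hc q hq hqp y k (by simpa [Subtype.ext_iff] using hy)
        exact Subtype.ext this.eq
  · push Not at hT
    refine IsPNilpotent.of_commute (default : Sylow p G) fun x hx => ?_
    by_cases hx1 : x = 1
    · subst hx1
      exact fun _ _ _ y _ _ => Commute.one_left y
    obtain ⟨k, hk⟩ := (default : Sylow p G).exists_pow_eq_one hx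
    exact (h x (hexp x k hk) hx1).resolve_left fun ⟨T, hTn, hTi, _⟩ => hT T hTn hTi

/-- An `S`-permutable subgroup of prime order `p`, with `p` the smallest prime divisor of `|G|`,
is centralized by all elements of prime power order coprime to `p`. -/
theorem IsSPermutable.commute {G : Type*} [Group G] [Finite G] {p : ℕ} (hp : p.Prime)
    (hmin : ∀ q : ℕ, q.Prime → q ∣ Nat.card G → p ≤ q) {H : Subgroup G}
    (hH : Nat.card H = p) (hperm : IsSPermutable H) {q : ℕ} (hq : q.Prime) (hqp : q ≠ p)
    {x y : G} {k : ℕ} (hx : x ∈ H) (hy : y ^ q ^ k = 1) : Commute x y := by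
  have := Fact.mk hp
  by_cases hy1 : y = 1
  · subst hy1; exact Commute.one_right x
  have hpq : p < q := by
    refine lt_of_le_of_ne (hmin q hq ?_) hqp.symm
    obtain ⟨j, -, hj⟩ := (Nat.dvd_prime_pow hq).1 (orderOf_dvd_of_pow_eq_one hy)
    have hj0 : j ≠ 0 := by
      rintro rfl
      exact hy1 (orderOf_eq_one_iff.1 (by simpa using hj))
    exact ((dvd_pow_self q hj0).trans (hj ▸ dvd_rfl)).trans (orderOf_dvd_natCard y)
  have hHp : IsPGroup p H := IsPGroup.of_card (n := 1) (by rw [hH, pow_one])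
  have hle : ∀ P : Sylow p G, H ≤ P := fun P => P.le_of_mul_comm hHp (hperm p hp P)
  obtain ⟨Q, hQ⟩ := exists_mem_sylow_of_pow_eq_one hy
  let P : Sylow p G := default
  -- `H` lies in every Sylow p-subgroup, so `y * h * y⁻¹` lies in `P`. Writing `y * h = h' * z` with
  -- `z ∈ Q` puts `z * y⁻¹` in `P ∩ Q = 1`.
  have hnorm : ∀ y ∈ (Q : Subgroup G), ∀ h ∈ H, y * h * y⁻¹ ∈ H := by
    intro y hy h hh
    have hyh : y * h * y⁻¹ ∈ (P : Subgroup G) := by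
      have h1 := hle (y⁻¹ • P) hh
      rw [Sylow.coe_subgroup_smul, Subgroup.mem_pointwise_smul_iff_inv_smul_mem] at h1
      simpa [← map_inv] using h1
    have hmem : y * h ∈ (H : Set G) * ((Q : Subgroup G) : Set G) := by
      rw [hperm q hq Q]
      exact Set.mul_mem_mul hy hh
    obtain ⟨h', hh', z, hz, e⟩ := hmem
    have e' : h' * z = y * h := e
    have hw : z * y⁻¹ ∈ (P : Subgroup G) := by
      have : z * y⁻¹ = h'⁻¹ * (y * h * y⁻¹) := by rw [← e']; group
      rw [this]
      exact mul_mem (inv_mem (hle P hh')) hyh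
    have := Fact.mk hq
    have hdis : Disjoint (P : Subgroup G) (Q : Subgroup G) :=
      IsPGroup.disjoint_of_ne p q hqp.symm _ _ P.2 Q.2
    have h1 : z * y⁻¹ = 1 := Subgroup.disjoint_def.1 hdis hw (mul_mem hz (inv_mem hy))
    rw [← e', mul_assoc, h1, mul_one]
    exact hh'
  have hyN : y ∈ Subgroup.normalizer (H : Set G) :=
    (Subgroup.le_normalizer_iff.2 hnorm) hQ
  have : IsCyclic H := isCyclic_of_prime_card hH
  -- `y` acts on `H` as a q-element of a group of order `p - 1`; as `q > p`, the action is trivial.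
  have h1 : orderOf (H.normalizerMonoidHom ⟨y, hyN⟩) ∣ q ^ k := by
    refine orderOf_dvd_of_pow_eq_one ?_
    rw [← map_pow]
    have : (⟨y, hyN⟩ : Subgroup.normalizer (H : Set G)) ^ q ^ k = 1 := Subtype.ext hy
    rw [this, map_one]
  have h2 : orderOf (H.normalizerMonoidHom ⟨y, hyN⟩) ∣ p - 1 := by
    have := orderOf_dvd_natCard (H.normalizerMonoidHom ⟨y, hyN⟩)
    rwa [IsCyclic.card_mulAut, hH, Nat.totient_prime hp] at this
  have hcop : (q ^ k).Coprime (p - 1) := by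
    refine Nat.Coprime.pow_left k ((hq.coprime_iff_not_dvd).2 fun hd => ?_)
    have := Nat.le_of_dvd (Nat.sub_pos_of_lt hp.one_lt) hd
    omega
  have h3 := Nat.eq_one_of_dvd_coprimes hcop h1 h2
  have h4 : (⟨y, hyN⟩ : Subgroup.normalizer (H : Set G)) ∈ H.normalizerMonoidHom.ker :=
    orderOf_eq_one_iff.1 h3
  rw [Subgroup.normalizerMonoidHom_ker, Subgroup.mem_subgroupOf,
    Subgroup.mem_centralizer_iff] at h4
  exact h4 x hx

theorem isAtom_of_prime_card {G : Type*} [Group G] {p : ℕ} (hp : p.Prime) {H : Subgroup G}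
    (hH : Nat.card H = p) : IsAtom H := by
  have := Fact.mk hp
  have : Finite H := Nat.finite_of_card_ne_zero (hH ▸ hp.ne_zero)
  refine ⟨fun h => hp.one_lt.ne ?_, fun K hK => ?_⟩
  · rw [← hH, h, Subgroup.card_bot]
  · rcases (Nat.dvd_prime hp).1 (hH ▸ Subgroup.card_dvd_of_le hK.le) with h | h
    · exact Subgroup.card_eq_one.1 h
    · exact absurd (Subgroup.eq_of_le_of_card_ge hK.le (by rw [hH, h])) hK.ne

theorem frattiniOf_eq_bot_of_isAtom {G : Type*} [Group G] {H : Subgroup G} (hH : IsAtom H) :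
    frattiniOf H = ⊥ := by
  have hco : IsCoatom (⊥ : Subgroup H) := by
    refine ⟨fun h => hH.1 ?_, fun K hK => ?_⟩
    · have := congrArg (Subgroup.map H.subtype) h
      simpa [← MonoidHom.range_eq_map] using this.symm
    · have hKH : K.map H.subtype ≤ H := Subgroup.map_subtype_le K
      rcases hH.le_iff.1 hKH with h | h
      · exact absurd ((Subgroup.map_eq_bot_iff_of_injective K H.subtype_injective).1 h) hK.ne'
      · refine Subgroup.map_injective H.subtype_injective ?_
        rw [h, ← MonoidHom.range_eq_map, Subgroup.range_subtype]
  rw [frattiniOf, le_bot_iff.1 (frattini_le_coatom hco), Subgroup.map_bot]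

theorem IsWeaklySPhiSupplemented.isSPermutable_or_isComplement' {G : Type*} [Group G]
    {H : Subgroup G} (hH : IsAtom H) (h : IsWeaklySPhiSupplemented H) :
    IsSPermutable H ∨ ∃ T : Subgroup G, Subgroup.IsComplement' H T := by
  by_cases hs : IsSPermutable H
  · exact Or.inl hs
  obtain ⟨T, hT, hi⟩ := h
  have hcore : sPermutableCore H = ⊥ := by
    refine le_bot_iff.1 (sSup_le fun B hB => ?_)
    rcases hH.le_iff.1 hB.1 with h | h
    · exact h.le
    · exact absurd (h ▸ hB.2) hs
  rw [frattiniOf_eq_bot_of_isAtom hH, hcore] at hi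
  refine Or.inr ⟨T, Subgroup.isComplement'_of_disjoint_and_mul_eq_univ ?_ hT⟩
  rw [Subgroup.disjoint_def]
  intro x hx hxT
  simpa using hi ⟨hx, hxT⟩

theorem mainTheorem2 {G : Type*} [Group G] [Finite G] (p : ℕ) (hp : p.Prime)
    (hpG : p ∣ Nat.card G) (hmin : ∀ q : ℕ, q.Prime → q ∣ Nat.card G → p ≤ q)
    (S : Sylow p G) (hexp : Monoid.exponent (S : Subgroup G) = p)
    (hS : ∀ H : Subgroup G, H ≤ (S : Subgroup G) → IsAtom H → IsWeaklySPhiSupplemented H) :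
    IsPNilpotent p G := by
  have := Fact.mk hp
  -- The hypotheses concern only `S`; conjugation extends them to all p-elements of `G`.
  have hconj : ∀ (x : G) (k : ℕ), x ^ p ^ k = 1 → ∃ g : G, g * x * g⁻¹ ∈ (S : Subgroup G) := by
    intro x k hx
    obtain ⟨P, hP⟩ := exists_mem_sylow_of_pow_eq_one hx
    obtain ⟨g, rfl⟩ := MulAction.exists_smul_eq G P S
    refine ⟨g, ?_⟩
    rw [Sylow.coe_subgroup_smul]
    exact Subgroup.smul_mem_pointwise_smul x (MulAut.conj g) _ hP
  refine isPNilpotent_of_normal_index_or_commute (Nat.card G) rfl ?_ ?_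
  · intro x k hx
    obtain ⟨g, hg⟩ := hconj x k hx
    have h1 : (⟨g * x * g⁻¹, hg⟩ : (S : Subgroup G)) ^ p = 1 := by
      exact orderOf_dvd_iff_pow_eq_one.1 ((Monoid.order_dvd_exponent _).trans hexp.dvd)
    have h2 : (g * x * g⁻¹) ^ p = 1 := by simpa [Subtype.ext_iff] using h1
    rwa [conj_pow, conj_eq_one_iff] at h2
  · intro x hx hx1
    obtain ⟨g, hg⟩ := hconj x 1 (by rwa [pow_one])
    have hcard : Nat.card (Subgroup.zpowers (g * x * g⁻¹)) = p := by
      rw [Nat.card_zpowers]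
      refine orderOf_eq_prime (by rw [conj_pow, hx]; simp) ?_
      rwa [Ne, conj_eq_one_iff]
    have hatom := isAtom_of_prime_card hp hcard
    rcases (hS _ ((Subgroup.zpowers_le).2 hg) hatom).isSPermutable_or_isComplement' hatom with
      hperm | ⟨T, hT⟩
    · refine Or.inr fun q hq hqp y k hy => ?_
      have := hperm.commute hp hmin hcard hq hqp (Subgroup.mem_zpowers _)
        (y := g * y * g⁻¹) (k := k) (by rw [conj_pow, hy]; simp)
      exact (Commute.conj_iff g).1 this
    · have hTi : T.index = p := hT.index_eq_card.trans hcard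
      have hTn : T.Normal := by
        refine Subgroup.normal_of_index_eq_minFac_card ?_
        rw [hTi]
        refine le_antisymm ?_ (Nat.minFac_le_of_dvd hp.two_le hpG)
        refine hmin _ (Nat.minFac_prime fun h1 => ?_) (Nat.minFac_dvd _)
        exact hp.one_lt.ne' (Nat.dvd_one.1 (h1 ▸ hpG))
      refine Or.inl ⟨T, hTn, hTi, fun hxT => hx1 ?_⟩
      have := Subgroup.disjoint_def.1 hT.disjoint (Subgroup.mem_zpowers _)
        (hTn.conj_mem x hxT g)
      exact conj_eq_one_iff.1 this
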